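/- Let $n\ge 1$, and let $\pi_1,\dots,\pi_n$ be independent, uniformly distributed random permutations of $\{1,2\}$. Put $$S_j=\frac{\sqrt{12}}{\sqrt{r(r+1)n}}\sum_{i=1}^n\Big(\pi_i(j)-\frac{r+1}{2}\Big)\quad(r=2,\ j=1,2),\qquad F_2=S_1^2+S_2^2$$ (Friedman's statistic for $r=2$ treatments and $n$ trials). Let $\chi^2_{(1)}$ denote the chi-square distribution with one degree of freedom, and write $\chi^2_{(1)}h=\mathbb{E}[h(Y)]$ for $Y\sim\chi^2_{(1)}$. Let $d_{\mathrm W}$ denote the Wasserstein distance, $d_{\mathrm W}(\mathcal L(X),\mathcal L(Y))=\sup_{h}|\mathbb{E}[h(X)]-\mathbb{E}[h(Y)]|$, where the supremum is over all $h:\mathbb{R}\to\mathbb{R}$ with Lipschitz constant at most $1$. Then $F_2$ and $\chi^2_{(1)}$ have finite first moments and $$d_{\mathrm W}(\mathcal L(F_2),\chi^2_{(1)})\le\frac{1}{\sqrt n}\Big(87+\frac{48}{\sqrt n}\Big).$$ Moreover, let $h:[0,\infty)\to\mathbb{R}$ be twice differentiable (with one-sided derivatives at $0$), with $h'$ and $h''$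 bounded; neither boundedness of $h$ nor continuity of $h''$ is assumed. Then $h(F_2)$ and $h(Y)$ are integrable and $$\big|\mathbb{E}[h(F_2)]-\chi^2_{(1)}h\big|\le\frac1n\Big(69+\frac{43}{n}\Big)\big(\|h'\|+\|h''\|\big),$$ where $\|g\|=\sup_{x\ge0}|g(x)|$. -/

import Mathlib

open MeasureTheory ProbabilityTheory
open scoped ENNReal

namespace Friedman

/-- The finite set of permutations carries the discrete sigma-algebra. -/
instance permMeasurableSpace (r : ℕ) : MeasurableSpace (Equiv.Perm (Fin r)) := ⊤

/-- The rankings `π 0, …, π (n - 1)` of `r` treatments in `n` trials under the null hypothesis: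
independent random permutations, each uniformly distributed. -/
structure IsUniformRankings {Ω : Type*} [MeasurableSpace Ω] (P : Measure Ω) {n r : ℕ}
    (π : Fin n → Ω → Equiv.Perm (Fin r)) : Prop where
  measurable : ∀ i, Measurable (π i)
  indep : iIndepFun π P
  uniform : ∀ i, P.map (π i) = uniformOn Set.univ

/-- The centred rank `ρ(j) = π(j) - (r + 1) / 2`. The ranks `1, …, r` of the treatments are the
elements of `Fin r` shifted by one. -/
noncomputable def centredRank {r : ℕ} (σ : Equiv.Perm (Fin r)) (j : Fin r) : ℝ :=
  (((σ j : ℕ) : ℝ) + 1) - ((r : ℝ) + 1) / 2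

/-- `S_j = √12 / √(r (r + 1) n) * ∑ i, ρ_i(j)`, for given rankings `σ`. -/
noncomputable def rankSum {n r : ℕ} (σ : Fin n → Equiv.Perm (Fin r)) (j : Fin r) : ℝ :=
  √12 / √((r : ℝ) * ((r : ℝ) + 1) * (n : ℝ)) * ∑ i, centredRank (σ i) j

/-- Friedman's statistic `F_r = ∑ j, S_j ^ 2`, for given rankings `σ`. -/
noncomputable def statistic {n r : ℕ} (σ : Fin n → Equiv.Perm (Fin r)) : ℝ :=
  ∑ j, rankSum σ j ^ 2

/-- The chi-square distribution with `p` degrees of freedom: the law of the sum of the squares of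
`p` independent standard normal random variables. -/
noncomputable def chiSquare (p : ℕ) : Measure ℝ :=
  (Measure.pi fun _ : Fin p => gaussianReal 0 1).map fun x => ∑ i, x i ^ 2

/-- The Wasserstein distance between two probability distributions on the line with finite first
moments: the supremum of `|E h(X) - E h(Y)|` over the `h` with Lipschitz constant at most `1`. -/
noncomputable def wassersteinDist (μ ν : Measure ℝ) : ℝ≥0∞ :=
  ⨆ (h : ℝ → ℝ) (_ : LipschitzWith 1 h), ENNReal.ofReal |∫ x, h x ∂μ - ∫ x, h x ∂ν|

/-- The `m`-th derivative of `h` on `[0, ∞)`, one-sided at `0`. Only the values of `h` on `[0, ∞)`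
matter. -/
noncomputable def derivPos (m : ℕ) (h : ℝ → ℝ) : ℝ → ℝ :=
  iteratedDerivWithin m h (Set.Ici 0)

/-- The class `C_b^{j,k}` of functions on `[0, ∞)` that are `k` times differentiable, with bounded
derivatives of orders `j, …, k`. The `k`-th derivative need not be continuous. -/
structure MemCb (j k : ℕ) (h : ℝ → ℝ) : Prop where
  differentiable : ∀ m < k, DifferentiableOn ℝ (derivPos m h) (Set.Ici 0)
  bounded : ∀ m, j ≤ m → m ≤ k → ∃ C : ℝ, ∀ x ∈ Set.Ici (0 : ℝ), |derivPos m h x| ≤ C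

/-- The supremum norm over `[0, ∞)` (of functions that are bounded there). -/
noncomputable def supNorm (g : ℝ → ℝ) : ℝ :=
  ⨆ x : Set.Ici (0 : ℝ), |g x|

end Friedman

/-!
For two treatments Friedman's statistic is `W ^ 2`, where `W` is a sum of `n` independent signs
scaled by `1 / √n`, and the chi-square law is that of `Z ^ 2` with `Z` standard normal. Solve
Stein's equation `ψ' - x ψ = h (x ^ 2) - E h (Z ^ 2)`. The difference of a solution and a barrier,
multiplied by the normal density, is monotone and vanishes at infinity; since `ψ'` and `ψ''` solve
Stein equations as well, this bounds `ψ` and its first three derivatives by polynomials. As every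
summand `X` of `W` takes the values `± c` with equal probabilities, `E (X ψ(W)) - c ^ 2 E ψ'(W)` is,
conditionally on the other summands, the error of the trapezoidal rule for `ψ'` on an interval of
length `2 c`, up to a factor `c / 2`. It is therefore of order `c ^ 4`, and the `n` errors add up to
order `1 / n`. For a Lipschitz test function the same bound is applied to its twofold Steklov mean
over intervals of length `1 / √n`.
-/

namespace Friedman

open Filter Set
open scoped Topology

section SteinEquation

local notation "φ" => gaussianPDFReal 0 1

theorem hasDerivAt_gaussianPDFReal (x : ℝ) : HasDerivAt φ (-(x * φ x)) x := by
  have hexp : HasDerivAt (fun x : ℝ => -(x - 0) ^ 2 / (2 * (1 : NNReal))) (-x) x :=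
    (((hasDerivAt_id' x).sub_const 0).fun_pow 2 |>.fun_neg.div_const _).congr_deriv (by simp; ring)
  exact (hexp.exp.const_mul (√(2 * Real.pi * (1 : NNReal)))⁻¹).congr_deriv
    (by rw [gaussianPDFReal]; ring)

theorem tendsto_mul_gaussianPDFReal {u : ℝ → ℝ} {a b c : ℝ} {l : Filter ℝ} (hl : l ≤ cocompact ℝ)
    (hu : ∀ᶠ x in l, |u x| ≤ a + b * |x| + c * x ^ 2) : Tendsto (fun x => u x * φ x) l (𝓝 0) := by
  have hpow (s : ℝ) := (tendsto_rpow_abs_mul_exp_neg_mul_sq_cocompact one_half_pos s).mono_left hl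
  have hlim := ((((hpow 0).const_mul a).add ((hpow 1).const_mul b)).add
    ((hpow 2).const_mul c)).const_mul (√(2 * Real.pi))⁻¹
  simp only [mul_zero, add_zero] at hlim
  refine squeeze_zero_norm' (hu.mono fun x hx => ?_) hlim
  have hφ : φ x = (√(2 * Real.pi))⁻¹ * Real.exp (-(1 / 2) * x ^ 2) := by
    simp only [gaussianPDFReal, NNReal.coe_one, mul_one, sub_zero]
    ring_nf
  calc ‖u x * φ x‖ = |u x| * φ x := by
        rw [norm_mul, Real.norm_eq_abs, Real.norm_of_nonneg (gaussianPDFReal_nonneg 0 1 x)]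
    _ ≤ (a + b * |x| + c * x ^ 2) * φ x := by gcongr; exact gaussianPDFReal_nonneg 0 1 x
    _ = _ := by
        rw [hφ, Real.rpow_zero, Real.rpow_one, Real.rpow_two, sq_abs]
        ring

theorem nonpos_of_mul_le_deriv {v v' : ℝ → ℝ} (hv : ∀ x, 0 ≤ x → HasDerivAt v (v' x) x)
    (hle : ∀ x, 0 ≤ x → x * v x ≤ v' x) (hlim : Tendsto (fun x => v x * φ x) atTop (𝓝 0))
    {x : ℝ} (hx : 0 ≤ x) : v x ≤ 0 := by
  have hφ (y : ℝ) : 0 < φ y := gaussianPDFReal_pos 0 1 y one_ne_zero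
  have hd (y : ℝ) (hy : 0 ≤ y) : HasDerivAt (fun x => v x * φ x) ((v' y - y * v y) * φ y) y :=
    ((hv y hy).fun_mul (hasDerivAt_gaussianPDFReal y)).congr_deriv (by ring)
  have hmono : MonotoneOn (fun x => v x * φ x) (Ici 0) :=
    monotoneOn_of_hasDerivWithinAt_nonneg (convex_Ici 0)
      (fun y hy => (hd y hy).continuousAt.continuousWithinAt)
      (fun y hy => (hd y (interior_subset hy)).hasDerivWithinAt)
      (fun y hy => mul_nonneg (sub_nonneg.2 (hle y (interior_subset hy))) (hφ y).le)
  have hle0 : v x * φ x ≤ 0 := ge_of_tendsto hlim <| (eventually_ge_atTop x).mono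
    fun y hy => hmono hx (hx.trans hy) hy
  exact nonpos_of_mul_nonpos_left hle0 (hφ x)

/-- `u` is the solution of Stein's equation `u' - x u = k` for the standard normal distribution
that is negligible against the reciprocal of the normal density at `±∞`. -/
structure IsSteinSolution (u k : ℝ → ℝ) : Prop where
  hasDerivAt : ∀ x, HasDerivAt u (x * u x + k x) x
  tendsto : Tendsto (fun x => u x * φ x) (cocompact ℝ) (𝓝 0)

namespace IsSteinSolution

variable {u k k' : ℝ → ℝ} {c p q : ℝ}

theorem neg (hu : IsSteinSolution u k) : IsSteinSolution (-u) (-k) where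
  hasDerivAt x := (hu.hasDerivAt x).neg.congr_deriv (by simp only [Pi.neg_apply]; ring)
  tendsto := by simpa only [Pi.neg_apply, neg_mul, neg_zero] using hu.tendsto.neg

theorem comp_neg (hu : IsSteinSolution u k) :
    IsSteinSolution (fun x => u (-x)) (fun x => -k (-x)) where
  hasDerivAt x := ((hu.hasDerivAt (-x)).comp x (hasDerivAt_neg x)).congr_deriv (by ring)
  tendsto := by
    have hφ (x : ℝ) : φ (-x) = φ x := by simp [gaussianPDFReal]
    simpa only [Function.comp_def, Homeomorph.coe_neg, hφ] using
      hu.tendsto.comp (Homeomorph.neg ℝ).isClosedEmbedding.tendsto_cocompact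

-- The barrier `p + q x + r / (1 + x)` is a supersolution because `x / (1 + x) + 1 / (1 + x) ^ 2`
-- is at least `3 / 4`.
theorem le_of_nonneg (hu : IsSteinSolution u k) (hq : 0 ≤ q)
    (hk : ∀ x, |k x| ≤ c + p * |x| + q * x ^ 2) {x : ℝ} (hx : 0 ≤ x) :
    u x ≤ p + q * x + 4 / 3 * (c + q) / (1 + x) := by
  set r := 4 / 3 * (c + q) with hr_def
  have hc : 0 ≤ c := by simpa using (abs_nonneg _).trans (hk 0)
  have hr : 0 ≤ r := by positivity
  have hbarrier (y : ℝ) (hy : 0 ≤ y) :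
      HasDerivAt (fun y => p + q * y + r / (1 + y)) (q - r / (1 + y) ^ 2) y := by
    have hne : 1 + y ≠ 0 := by positivity
    exact ((((hasDerivAt_id' y).const_mul q).const_add p).fun_add
      ((hasDerivAt_const y r).fun_div ((hasDerivAt_id' y).const_add 1) hne)).congr_deriv (by ring)
  refine sub_nonpos.1 <| nonpos_of_mul_le_deriv
    (fun y hy => (hu.hasDerivAt y).fun_sub (hbarrier y hy)) (fun y hy => ?_) ?_ hx
  · have hsuper : c + q ≤ y * (r / (1 + y)) + r / (1 + y) ^ 2 := by
      rw [show y * (r / (1 + y)) + r / (1 + y) ^ 2 = r * (y ^ 2 + y + 1) / (1 + y) ^ 2 by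
        field_simp; ring, le_div_iff₀ (by positivity)]
      nlinarith [mul_nonneg (add_nonneg hc hq) (sq_nonneg (y - 1))]
    have hky := neg_le_of_abs_le (hk y)
    rw [abs_of_nonneg hy] at hky
    linarith
  · have hbarrier_lim : Tendsto (fun y => (p + q * y + r / (1 + y)) * φ y) atTop (𝓝 0) := by
      refine tendsto_mul_gaussianPDFReal (a := |p| + r) (b := q) (c := 0) atTop_le_cocompact ?_
      filter_upwards [eventually_ge_atTop 0] with y hy
      have hdiv : |r / (1 + y)| ≤ r := by
        rw [abs_of_nonneg (by positivity)]
        exact div_le_self hr (by linarith)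
      have hlin : |q * y| = q * |y| := by rw [abs_mul, abs_of_nonneg hq]
      linarith [abs_add_three p (q * y) (r / (1 + y))]
    simpa only [sub_mul, sub_zero] using
      (hu.tendsto.mono_left atTop_le_cocompact).sub hbarrier_lim

protected theorem abs_le (hu : IsSteinSolution u k) (hq : 0 ≤ q)
    (hk : ∀ x, |k x| ≤ c + p * |x| + q * x ^ 2) (x : ℝ) :
    |u x| ≤ p + q * |x| + 4 / 3 * (c + q) / (1 + |x|) := by
  wlog hx : 0 ≤ x generalizing u k x
  · simpa using this hu.comp_neg (fun x => by simpa using hk (-x)) (-x) (by linarith)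
  rw [abs_of_nonneg hx]
  exact abs_le'.2 ⟨hu.le_of_nonneg hq hk hx, hu.neg.le_of_nonneg hq (by simpa using hk) hx⟩

theorem deriv_eq (hu : IsSteinSolution u k) (x : ℝ) : deriv u x = x * u x + k x :=
  (hu.hasDerivAt x).deriv

protected theorem deriv (hu : IsSteinSolution u k) (hq : 0 ≤ q)
    (hk : ∀ x, |k x| ≤ c + p * |x| + q * x ^ 2) (hk' : ∀ x, HasDerivAt k (k' x) x) :
    IsSteinSolution (deriv u) (fun x => u x + k' x) where
  hasDerivAt x := by
    simp only [funext hu.deriv_eq]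
    exact (((hasDerivAt_id' x).fun_mul (hu.hasDerivAt x)).fun_add (hk' x)).congr_deriv (by ring)
  tendsto := by
    have hr : 0 ≤ 4 / 3 * (c + q) := by
      have hc : 0 ≤ c := by simpa using (abs_nonneg _).trans (hk 0)
      positivity
    refine tendsto_mul_gaussianPDFReal (a := c) (b := 2 * p + 4 / 3 * (c + q)) (c := 2 * q) le_rfl
      (.of_forall fun x => ?_)
    have hdiv : 4 / 3 * (c + q) / (1 + |x|) ≤ 4 / 3 * (c + q) :=
      div_le_self hr (by linarith [abs_nonneg x])
    calc |_root_.deriv u x| ≤ |x| * |u x| + |k x| := by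
          rw [hu.deriv_eq, ← abs_mul]
          exact abs_add_le _ _
      _ ≤ |x| * (p + q * |x| + 4 / 3 * (c + q)) + (c + p * |x| + q * x ^ 2) := by
          gcongr
          · exact (hu.abs_le hq hk x).trans (by gcongr)
          · exact hk x
      _ = _ := by linear_combination q * sq_abs x

end IsSteinSolution

/-- The classical solution of Stein's equation `u' - x u = k`. -/
noncomputable def steinSol (k : ℝ → ℝ) (x : ℝ) : ℝ :=
  (φ x)⁻¹ * ∫ t in Iic x, φ t * k t

theorem isSteinSolution_steinSol {k : ℝ → ℝ} (hc : Continuous k)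
    (hk : Integrable k (gaussianReal 0 1)) (h0 : ∫ x, k x ∂(gaussianReal 0 1) = 0) :
    IsSteinSolution (steinSol k) k := by
  have hφ (x : ℝ) : φ x ≠ 0 := (gaussianPDFReal_pos 0 1 x one_ne_zero).ne'
  have hint : Integrable fun t => φ t * k t := by
    rw [gaussianReal_of_var_ne_zero 0 one_ne_zero, integrable_withDensity_iff_integrable_smul'
      (by fun_prop) (ae_of_all _ fun _ => gaussianPDF_lt_top)] at hk
    simpa only [toReal_gaussianPDF, smul_eq_mul] using hk
  have hzero : ∫ t, φ t * k t = 0 := by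
    rwa [integral_gaussianReal_eq_integral_smul one_ne_zero] at h0
  have hφc : Continuous φ :=
    continuous_iff_continuousAt.2 fun x => (hasDerivAt_gaussianPDFReal x).continuousAt
  have hprim (x : ℝ) : HasDerivAt (fun x => ∫ t in Iic x, φ t * k t) (φ x * k x) x := by
    refine ((((hφc.mul hc).integral_hasStrictDerivAt 0 x).hasDerivAt.add_const
      (∫ t in Iic 0, φ t * k t)).congr_of_eventuallyEq (.of_forall fun y => ?_))
    simp only [Pi.mul_apply,
      ← intervalIntegral.integral_Iic_sub_Iic hint.integrableOn hint.integrableOn, sub_add_cancel]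
  constructor
  · intro x
    refine (((hasDerivAt_gaussianPDFReal x).fun_inv (hφ x)).fun_mul (hprim x)).congr_deriv ?_
    rw [steinSol]
    field_simp [hφ x]
  · have hmul : (fun x => steinSol k x * φ x) = fun x => ∫ t in Iic x, φ t * k t := by
      ext x
      rw [steinSol, mul_comm, mul_inv_cancel_left₀ (hφ x)]
    rw [hmul, cocompact_eq_atBot_atTop, tendsto_sup]
    refine ⟨tendsto_integral_Iic_zero tendsto_id, ?_⟩
    simpa only [hzero, id] using
      (aecover_Iic tendsto_id).integral_tendsto_of_countably_generated hint

end SteinEquation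

section ThirdDerivative

/-- `k`, with first and second derivatives `k'` and `k''`, grows like `x ↦ h (x ^ 2)` does for a
function `h` with `|h'| ≤ C` and `4 |h''| ≤ D`. -/
structure HasQuadraticGrowth (k k' k'' : ℝ → ℝ) (C D : ℝ) : Prop where
  hasDerivAt : ∀ x, HasDerivAt k (k' x) x
  hasDerivAt_deriv : ∀ x, HasDerivAt k' (k'' x) x
  nonneg : 0 ≤ D
  bound : ∀ x, |k x| ≤ C * (1 + x ^ 2)
  bound_deriv : ∀ x, |k' x| ≤ 2 * C * |x|
  bound_deriv_deriv : ∀ x, |k'' x| ≤ 2 * C + D * x ^ 2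

variable {ψ k k' k'' : ℝ → ℝ} {C D : ℝ}

theorem HasQuadraticGrowth.nonneg_left (hk : HasQuadraticGrowth k k' k'' C D) : 0 ≤ C := by
  simpa using (abs_nonneg _).trans (hk.bound 0)

theorem HasQuadraticGrowth.bound_add (hk : HasQuadraticGrowth k k' k'' C D) (x : ℝ) :
    |k x| ≤ C + 0 * |x| + C * x ^ 2 :=
  (hk.bound x).trans_eq (by ring)

namespace IsSteinSolution

theorem abs_deriv_forcing_le (hψ : IsSteinSolution ψ k) (hk : HasQuadraticGrowth k k' k'' C D)
    (x : ℝ) : |ψ x + k' x| ≤ 8 / 3 * C + 3 * C * |x| + 0 * x ^ 2 := by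
  have hC := hk.nonneg_left
  have hψ_le := hψ.abs_le hC hk.bound_add x
  have hdiv : 4 / 3 * (C + C) / (1 + |x|) ≤ 4 / 3 * (C + C) :=
    div_le_self (by positivity) (by linarith [abs_nonneg x])
  linarith [abs_add_le (ψ x) (k' x), hk.bound_deriv x]

theorem abs_deriv_le (hψ : IsSteinSolution ψ k) (hk : HasQuadraticGrowth k k' k'' C D) (x : ℝ) :
    |deriv ψ x| ≤ 59 / 9 * C := by
  have hC := hk.nonneg_left
  have hψ'_le :=
    (hψ.deriv hC hk.bound_add hk.hasDerivAt).abs_le le_rfl (hψ.abs_deriv_forcing_le hk) x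
  have hdiv : 4 / 3 * (8 / 3 * C + 0) / (1 + |x|) ≤ 4 / 3 * (8 / 3 * C + 0) :=
    div_le_self (by positivity) (by linarith [abs_nonneg x])
  linarith

theorem deriv_deriv (hψ : IsSteinSolution ψ k) (hk : HasQuadraticGrowth k k' k'' C D) :
    IsSteinSolution (deriv (deriv ψ)) (fun x => deriv ψ x + (deriv ψ x + k'' x)) :=
  (hψ.deriv hk.nonneg_left hk.bound_add hk.hasDerivAt).deriv le_rfl (hψ.abs_deriv_forcing_le hk)
    fun x => (hψ.hasDerivAt x).differentiableAt.hasDerivAt.fun_add (hk.hasDerivAt_deriv x)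

theorem abs_deriv_deriv_forcing_le (hψ : IsSteinSolution ψ k) (hk : HasQuadraticGrowth k k' k'' C D)
    (x : ℝ) : |deriv ψ x + (deriv ψ x + k'' x)| ≤ 136 / 9 * C + 0 * |x| + D * x ^ 2 := by
  rw [← add_assoc]
  linarith [abs_add_three (deriv ψ x) (deriv ψ x) (k'' x), hk.bound_deriv_deriv x,
    hψ.abs_deriv_le hk x]

theorem abs_deriv_deriv_deriv_le (hψ : IsSteinSolution ψ k) (hk : HasQuadraticGrowth k k' k'' C D)
    (x : ℝ) : |deriv (deriv (deriv ψ)) x| ≤ 36 * C + 2 * D + 2 * D * x ^ 2 := by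
  have hC := hk.nonneg_left
  have hD := hk.nonneg
  have hψ''_le := (hψ.deriv_deriv hk).abs_le hD (hψ.abs_deriv_deriv_forcing_le hk) x
  set r := 4 / 3 * (136 / 9 * C + D) with hr
  have hdiv : |x| * (r / (1 + |x|)) ≤ r := by
    rw [mul_div_assoc', div_le_iff₀ (by positivity)]
    linarith [show 0 ≤ r by positivity]
  calc |deriv (deriv (deriv ψ)) x|
      ≤ |x| * |deriv (deriv ψ) x| + |deriv ψ x + (deriv ψ x + k'' x)| := by
        rw [(hψ.deriv_deriv hk).deriv_eq, ← abs_mul]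
        exact abs_add_le _ _
    _ ≤ |x| * (0 + D * |x| + r / (1 + |x|)) + (136 / 9 * C + 0 * |x| + D * x ^ 2) := by
        gcongr
        exact hψ.abs_deriv_deriv_forcing_le hk x
    _ ≤ 36 * C + 2 * D + 2 * D * x ^ 2 := by
        linear_combination hdiv + hr + D * sq_abs x + 20 / 27 * hC + 2 / 3 * hD

end IsSteinSolution

end ThirdDerivative

section Trapezoid

open scoped Interval

theorem abs_trapezoidal_error_le {f : ℝ → ℝ} {a b K : ℝ} (hab : a < b) (hf : Differentiable ℝ f)
    (hf' : Differentiable ℝ (deriv f)) (hK : ∀ x ∈ [[a, b]], |deriv (deriv f) x| ≤ K) :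
    |trapezoidal_error f 1 a b| ≤ K * (b - a) ^ 3 / 12 := by
  have hderiv : EqOn (derivWithin f [[a, b]]) (deriv f) [[a, b]] := fun x hx =>
    (hf x).derivWithin (uniqueDiffOn_uIcc hab.ne x hx)
  have hbound (x : ℝ) : |iteratedDerivWithin 2 f [[a, b]] x| ≤ K := by
    rw [iteratedDerivWithin_succ, iteratedDerivWithin_one]
    by_cases hx : x ∈ [[a, b]]
    · rw [derivWithin_congr hderiv (hderiv hx), (hf' x).derivWithin (uniqueDiffOn_uIcc hab.ne x hx)]
      exact hK x hx
    · rw [derivWithin_zero_of_notMem_closure (by rwa [isCompact_uIcc.isClosed.closure_eq]),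
        abs_zero]
      exact (abs_nonneg _).trans (hK a left_mem_uIcc)
  refine (trapezoidal_error_le hf.differentiableOn (hf'.differentiableOn.congr hderiv) hbound
    one_pos).trans_eq ?_
  rw [abs_of_pos (sub_pos.2 hab)]
  norm_num
  ring

theorem abs_sub_sub_mul_deriv_add_le {ψ : ℝ → ℝ} {a b x δ : ℝ} (hδ : 0 ≤ δ)
    (hψ : Differentiable ℝ ψ) (hψ' : Differentiable ℝ (deriv ψ))
    (hψ'' : Differentiable ℝ (deriv (deriv ψ))) (hb : 0 ≤ b)
    (hbound : ∀ x, |deriv (deriv (deriv ψ)) x| ≤ a + b * x ^ 2) :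
    |ψ (x + δ) - ψ (x - δ) - δ * (deriv ψ (x + δ) + deriv ψ (x - δ))| ≤
      2 / 3 * δ ^ 3 * (a + b * ((x + δ) ^ 2 + (x - δ) ^ 2)) := by
  rcases hδ.eq_or_lt with rfl | hδ
  · simp
  have hftc : ∫ t in (x - δ)..(x + δ), deriv ψ t = ψ (x + δ) - ψ (x - δ) :=
    intervalIntegral.integral_deriv_eq_sub (fun t _ => hψ t)
      (hψ'.continuous.intervalIntegrable _ _)
  have herror : ψ (x + δ) - ψ (x - δ) - δ * (deriv ψ (x + δ) + deriv ψ (x - δ)) =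
      -trapezoidal_error (deriv ψ) 1 (x - δ) (x + δ) := by
    rw [trapezoidal_error, trapezoidal_integral_one, hftc]
    ring
  rw [herror, abs_neg]
  refine (abs_trapezoidal_error_le (by linarith) hψ' hψ'' fun t ht => (hbound t).trans
    (?_ : _ ≤ a + b * ((x + δ) ^ 2 + (x - δ) ^ 2))).trans_eq (by ring)
  obtain ⟨hl, hr⟩ := uIcc_of_le (by linarith : x - δ ≤ x + δ) ▸ ht
  gcongr
  rcases le_total 0 t with h | h <;> nlinarith [sq_nonneg (x + δ), sq_nonneg (x - δ)]

end Trapezoid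

section Rademacher

variable {Ω : Type*} [MeasurableSpace Ω] {P : Measure Ω} [IsProbabilityMeasure P]

theorem integral_comp_eq_half_add {E : Type*} [MeasurableSpace E] {R : Ω → E} {X : Ω → ℝ} {c : ℝ}
    (hRX : IndepFun R X P) (hR : Measurable R) (hX : Measurable X) (habs : ∀ᵐ ω ∂P, |X ω| = c)
    (hmean : ∫ ω, X ω ∂P = 0) {G : E → ℝ → ℝ} (hG : ∀ x, Measurable fun r => G r x)
    (hint : ∀ x, Integrable (fun ω => G (R ω) x) P) :
    ∫ ω, G (R ω) (X ω) ∂P = ∫ ω, (G (R ω) c + G (R ω) (-c)) / 2 ∂P := by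
  have hsplit : ∀ᵐ ω ∂P, G (R ω) (X ω) = (G (R ω) c + G (R ω) (-c)) / 2 +
      (G (R ω) c - G (R ω) (-c)) / (2 * c) * X ω := by
    filter_upwards [habs] with ω hω
    rcases eq_or_ne c 0 with rfl | hc
    · simp [abs_eq_zero.1 hω]
    · rcases eq_or_eq_neg_of_abs_eq hω with h | h <;> rw [h] <;> field_simp <;> ring
  have hD : Measurable fun r => (G r c - G r (-c)) / (2 * c) := ((hG c).sub (hG (-c))).div_const _
  have hDX : IndepFun (fun ω => (G (R ω) c - G (R ω) (-c)) / (2 * c)) X P :=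
    hRX.comp hD measurable_id
  have hDint : Integrable (fun ω => (G (R ω) c - G (R ω) (-c)) / (2 * c)) P :=
    ((hint c).sub (hint (-c))).div_const _
  have hXint : Integrable X P := .of_bound hX.aestronglyMeasurable c (habs.mono fun ω hω => hω.le)
  have hmid : Integrable (fun ω => (G (R ω) c + G (R ω) (-c)) / 2) P :=
    ((hint c).add (hint (-c))).div_const 2
  have hprod : Integrable (fun ω => (G (R ω) c - G (R ω) (-c)) / (2 * c) * X ω) P :=
    hDX.integrable_mul hDint hXint
  rw [integral_congr_ae hsplit, integral_add hmid hprod, hDX.integral_fun_mul_eq_mul_integral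
    (hD.comp hR).aestronglyMeasurable hX.aestronglyMeasurable, hmean, mul_zero, add_zero]

/-- The `X i` are independent centred random variables taking the values `±c i` only, that is,
Rademacher variables scaled by the `c i`. -/
structure IsScaledRademacher {ι : Type*} (P : Measure Ω) (c : ι → ℝ) (X : ι → Ω → ℝ) : Prop where
  measurable : ∀ i, Measurable (X i)
  indep : iIndepFun X P
  abs_eq : ∀ i, ∀ᵐ ω ∂P, |X i ω| = c i
  integral_eq_zero : ∀ i, ∫ ω, X i ω ∂P = 0

namespace IsScaledRademacher

variable {ι : Type*} {c : ι → ℝ} {X : ι → Ω → ℝ}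

theorem nonneg (hX : IsScaledRademacher P c X) (i : ι) : 0 ≤ c i := by
  obtain ⟨ω, hω⟩ := (hX.abs_eq i).exists
  exact hω ▸ abs_nonneg _

theorem integrable_comp [Finite ι] (hX : IsScaledRademacher P c X) {f : (ι → ℝ) → ℝ}
    (hf : Continuous f) : Integrable (fun ω => f fun i => X i ω) P := by
  obtain ⟨C, hC⟩ := (isCompact_Icc (a := -c) (b := c)).exists_bound_of_continuousOn hf.continuousOn
  refine .of_bound (hf.measurable.comp (measurable_pi_lambda _ hX.measurable)).aestronglyMeasurable
    C ?_
  filter_upwards [ae_all_iff.2 hX.abs_eq] with ω hω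
  exact hC _ ⟨fun i => neg_le_of_abs_le (hω i).le, fun i => le_of_abs_le (hω i).le⟩

variable [Fintype ι]

theorem integral_eq_half_add [DecidableEq ι] (hX : IsScaledRademacher P c X) (i : ι)
    {G : ℝ → ℝ → ℝ} (hG : ∀ x, Continuous fun r => G r x) :
    ∫ ω, G (∑ j ∈ Finset.univ.erase i, X j ω) (X i ω) ∂P =
      ∫ ω, (G (∑ j ∈ Finset.univ.erase i, X j ω) (c i) +
        G (∑ j ∈ Finset.univ.erase i, X j ω) (-c i)) / 2 ∂P := by
  have hindep : IndepFun (fun ω => ∑ j ∈ Finset.univ.erase i, X j ω) (X i) P := by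
    simpa only [Finset.sum_fn] using
      hX.indep.indepFun_finsetSum_of_notMem hX.measurable (Finset.notMem_erase i _)
  exact integral_comp_eq_half_add hindep
    (Finset.measurable_fun_sum _ fun j _ => hX.measurable j) (hX.measurable i) (hX.abs_eq i)
    (hX.integral_eq_zero i) (fun x => (hG x).measurable)
    fun x => hX.integrable_comp (f := fun y => G (∑ j ∈ Finset.univ.erase i, y j) x)
      ((hG x).comp (by fun_prop))

theorem integral_mul_sub_eq [DecidableEq ι] (hX : IsScaledRademacher P c X) (i : ι) {f g : ℝ → ℝ}
    (hf : Continuous f) (hg : Continuous g) :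
    ∫ ω, (X i ω * f (∑ j, X j ω) - c i ^ 2 * g (∑ j, X j ω)) ∂P =
      c i / 2 * ∫ ω, (f (∑ j ∈ Finset.univ.erase i, X j ω + c i) -
        f (∑ j ∈ Finset.univ.erase i, X j ω - c i) -
        c i * (g (∑ j ∈ Finset.univ.erase i, X j ω + c i) +
          g (∑ j ∈ Finset.univ.erase i, X j ω - c i))) ∂P := by
  simp only [← Finset.sum_erase_add _ _ (Finset.mem_univ i)]
  rw [hX.integral_eq_half_add i (G := fun r x => x * f (r + x) - c i ^ 2 * g (r + x))
    fun x => by fun_prop, ← integral_const_mul]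
  congr 1 with ω
  ring_nf

theorem integral_sum_sq (hX : IsScaledRademacher P c X) :
    ∫ ω, (∑ i, X i ω) ^ 2 ∂P = ∑ i, c i ^ 2 := by
  classical
  have hmul (i : ι) : ∫ ω, X i ω * ∑ j, X j ω ∂P = c i ^ 2 := by
    simp only [← Finset.sum_erase_add _ _ (Finset.mem_univ i)]
    rw [hX.integral_eq_half_add i (G := fun r x => x * (r + x)) fun x => by fun_prop]
    ring_nf
    simp only [integral_const, probReal_univ, one_smul]
  simp only [sq, Finset.sum_mul]
  rw [integral_finsetSum _ fun i _ =>
    hX.integrable_comp (f := fun x => x i * ∑ j, x j) (by fun_prop)]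
  simp only [hmul, sq]

theorem abs_integral_mul_sub_le (hX : IsScaledRademacher P c X) (i : ι) {ψ : ℝ → ℝ} {a b : ℝ}
    (hψ : Differentiable ℝ ψ) (hψ' : Differentiable ℝ (deriv ψ))
    (hψ'' : Differentiable ℝ (deriv (deriv ψ))) (hb : 0 ≤ b)
    (hbound : ∀ x, |deriv (deriv (deriv ψ)) x| ≤ a + b * x ^ 2) :
    |∫ ω, (X i ω * ψ (∑ j, X j ω) - c i ^ 2 * deriv ψ (∑ j, X j ω)) ∂P| ≤
      c i ^ 4 / 3 * (a + 2 * b * ∑ j, c j ^ 2) := by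
  classical
  set R := fun ω => ∑ j ∈ Finset.univ.erase i, X j ω
  have hsq : ∫ ω, ((R ω + c i) ^ 2 + (R ω - c i) ^ 2) ∂P = 2 * ∑ j, c j ^ 2 := by
    rw [← hX.integral_sum_sq, ← integral_const_mul]
    simp only [← Finset.sum_erase_add _ _ (Finset.mem_univ i)]
    rw [integral_const_mul, hX.integral_eq_half_add i (G := fun r x => (r + x) ^ 2)
      fun x => by fun_prop, ← integral_const_mul]
    congr 1 with ω
    ring
  have hint : Integrable (fun ω => (R ω + c i) ^ 2 + (R ω - c i) ^ 2) P :=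
    hX.integrable_comp (f := fun x => (∑ j ∈ Finset.univ.erase i, x j + c i) ^ 2 +
      (∑ j ∈ Finset.univ.erase i, x j - c i) ^ 2) (by fun_prop)
  have herror : |∫ ω, (ψ (R ω + c i) - ψ (R ω - c i) -
      c i * (deriv ψ (R ω + c i) + deriv ψ (R ω - c i))) ∂P| ≤
      2 / 3 * c i ^ 3 * (a + b * (2 * ∑ j, c j ^ 2)) := by
    have hbound_int : Integrable (fun ω => 2 / 3 * c i ^ 3 *
        (a + b * ((R ω + c i) ^ 2 + (R ω - c i) ^ 2))) P :=
      ((integrable_const a).add (hint.const_mul b)).const_mul _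
    rw [← Real.norm_eq_abs]
    refine (norm_integral_le_of_norm_le hbound_int (ae_of_all _ fun ω => ?_)).trans_eq ?_
    · exact abs_sub_sub_mul_deriv_add_le (hX.nonneg i) hψ hψ' hψ'' hb hbound
    rw [integral_const_mul, integral_add (integrable_const a) (hint.const_mul b),
      integral_const_mul, hsq]
    simp
  rw [hX.integral_mul_sub_eq i hψ.continuous hψ'.continuous, abs_mul,
    abs_of_nonneg (by linarith [hX.nonneg i])]
  refine (mul_le_mul_of_nonneg_left herror (by linarith [hX.nonneg i])).trans_eq ?_
  ring

theorem abs_integral_sum_mul_sub_le (hX : IsScaledRademacher P c X) {ψ : ℝ → ℝ} {a b : ℝ}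
    (hψ : Differentiable ℝ ψ) (hψ' : Differentiable ℝ (deriv ψ))
    (hψ'' : Differentiable ℝ (deriv (deriv ψ))) (hb : 0 ≤ b)
    (hbound : ∀ x, |deriv (deriv (deriv ψ)) x| ≤ a + b * x ^ 2) :
    |∫ ω, ((∑ i, X i ω) * ψ (∑ i, X i ω) - (∑ i, c i ^ 2) * deriv ψ (∑ i, X i ω)) ∂P| ≤
      (∑ i, c i ^ 4) / 3 * (a + 2 * b * ∑ i, c i ^ 2) := by
  have := hψ.continuous
  have := hψ'.continuous
  simp only [Finset.sum_mul, ← Finset.sum_sub_distrib]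
  rw [integral_finsetSum _ fun i _ => hX.integrable_comp
    (f := fun x => x i * ψ (∑ j, x j) - c i ^ 2 * deriv ψ (∑ j, x j)) (by fun_prop),
    Finset.sum_div, Finset.sum_mul]
  exact (Finset.abs_sum_le_sum_abs _ _).trans
    (Finset.sum_le_sum fun i _ => hX.abs_integral_mul_sub_le i hψ hψ' hψ'' hb hbound)

theorem abs_integral_le_of_isSteinSolution (hX : IsScaledRademacher P c X)
    (hc : ∑ i, c i ^ 2 = 1) {ψ k k' k'' : ℝ → ℝ} {C D : ℝ} (hψ : IsSteinSolution ψ k)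
    (hk : HasQuadraticGrowth k k' k'' C D) :
    |∫ ω, k (∑ i, X i ω) ∂P| ≤ (∑ i, c i ^ 4) * (12 * C + 2 * D) := by
  have hψ' := hψ.deriv hk.nonneg_left hk.bound_add hk.hasDerivAt
  have hψ'' := hψ.deriv_deriv hk
  have hstein (x : ℝ) : x * ψ x - 1 * deriv ψ x = -k x := by
    rw [hψ.deriv_eq]
    ring
  have hle := hX.abs_integral_sum_mul_sub_le (fun x => (hψ.hasDerivAt x).differentiableAt)
    (fun x => (hψ'.hasDerivAt x).differentiableAt) (fun x => (hψ''.hasDerivAt x).differentiableAt)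
    (mul_nonneg zero_le_two hk.nonneg) (hψ.abs_deriv_deriv_deriv_le hk)
  simp only [hc, hstein, integral_neg, abs_neg] at hle
  exact hle.trans_eq (by ring)

end IsScaledRademacher

end Rademacher

section ChiSquare

theorem integral_sq_gaussianReal : ∫ x, x ^ 2 ∂(gaussianReal 0 1) = 1 := by
  have hvar := variance_id_gaussianReal (μ := 0) (v := 1)
  rw [variance_eq_integral (by fun_prop)] at hvar
  simpa using hvar

theorem measurable_sum_sq {p : ℕ} : Measurable fun x : Fin p → ℝ => ∑ i, x i ^ 2 := by
  fun_prop

instance (p : ℕ) : IsProbabilityMeasure (chiSquare p) :=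
  Measure.isProbabilityMeasure_map measurable_sum_sq.aemeasurable

theorem ae_mem_Ici_chiSquare (p : ℕ) : ∀ᵐ x ∂(chiSquare p), x ∈ Ici (0 : ℝ) := by
  refine (ae_map_iff measurable_sum_sq.aemeasurable measurableSet_Ici).2 ?_
  exact ae_of_all _ fun x => Finset.sum_nonneg fun i _ => sq_nonneg (x i)

theorem integrable_sq_eval_pi_gaussianReal {p : ℕ} (i : Fin p) :
    Integrable (fun x : Fin p → ℝ => x i ^ 2) (Measure.pi fun _ => gaussianReal 0 1) :=
  (measurePreserving_eval (fun _ : Fin p => gaussianReal 0 1) i).integrable_comp_of_integrable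
    (g := fun y => y ^ 2) (memLp_id_gaussianReal 2).integrable_sq

theorem integrable_id_chiSquare (p : ℕ) : Integrable (fun x => x) (chiSquare p) :=
  (integrable_map_measure (by fun_prop) measurable_sum_sq.aemeasurable).2
    (integrable_finsetSum _ fun i _ => integrable_sq_eval_pi_gaussianReal i)

theorem integral_id_chiSquare (p : ℕ) : ∫ x, x ∂(chiSquare p) = p := by
  have heval (i : Fin p) :
      ∫ x : Fin p → ℝ, x i ^ 2 ∂(Measure.pi fun _ => gaussianReal 0 1) = 1 := by
    rw [← integral_sq_gaussianReal]
    exact integral_comp_eval (μ := fun _ : Fin p => gaussianReal 0 1) (i := i)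
      (f := fun y : ℝ => y ^ 2) (by fun_prop)
  rw [chiSquare, integral_map measurable_sum_sq.aemeasurable (by fun_prop),
    integral_finsetSum _ fun i _ => integrable_sq_eval_pi_gaussianReal i]
  simp [heval]

theorem chiSquare_one_eq_map : chiSquare 1 = (gaussianReal 0 1).map fun x => x ^ 2 := by
  rw [← (measurePreserving_eval (fun _ : Fin 1 => gaussianReal 0 1) 0).map_eq,
    Measure.map_map (by fun_prop) (by fun_prop), chiSquare]
  simp only [Finset.univ_unique, Fin.default_eq_zero, Finset.sum_singleton, Function.comp_def,
    Function.eval]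

end ChiSquare

section TestFunctions

theorem integrable_of_lipschitzOnWith {E F : Type*} [NormedAddCommGroup E] [MeasurableSpace E]
    [OpensMeasurableSpace E] [NormedAddCommGroup F] [SecondCountableTopologyEither E F]
    {ν : Measure E} [IsFiniteMeasure ν] {K : NNReal} {s : Set E} {h : E → F} {x₀ : E}
    (hh : LipschitzOnWith K h s) (hs : MeasurableSet s) (hx₀ : x₀ ∈ s) (hν : ∀ᵐ x ∂ν, x ∈ s)
    (hid : Integrable (fun x => x) ν) : Integrable h ν := by
  have hmeas : AEStronglyMeasurable h ν := by
    rw [← Measure.restrict_eq_self_of_ae_mem hν]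
    exact hh.continuousOn.aestronglyMeasurable hs
  refine (((hid.sub (integrable_const x₀)).norm.const_mul (K : ℝ)).add
    (integrable_const ‖h x₀‖)).mono' hmeas ?_
  filter_upwards [hν] with x hx
  exact (norm_le_norm_sub_add _ _).trans (add_le_add_left (hh.norm_sub_le hx hx₀) _)

/-- `h` is twice differentiable on `[0, ∞)`, with derivatives `h'` and `h''` bounded by `A` and
`B` there. -/
structure HasBoundedDerivs (h h' h'' : ℝ → ℝ) (A B : ℝ) : Prop where
  hasDerivWithinAt : ∀ x ∈ Ici (0 : ℝ), HasDerivWithinAt h (h' x) (Ici 0) x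
  hasDerivWithinAt_deriv : ∀ x ∈ Ici (0 : ℝ), HasDerivWithinAt h' (h'' x) (Ici 0) x
  bound : ∀ x ∈ Ici (0 : ℝ), |h' x| ≤ A
  bound_deriv : ∀ x ∈ Ici (0 : ℝ), |h'' x| ≤ B

theorem hasDerivAt_comp_sq {h h' : ℝ → ℝ}
    (hh : ∀ x ∈ Ici (0 : ℝ), HasDerivWithinAt h (h' x) (Ici 0) x) (x : ℝ) :
    HasDerivAt (fun x => h (x ^ 2)) (2 * x * h' (x ^ 2)) x := by
  have hsq : HasDerivAt (fun x : ℝ => x ^ 2) (2 * x) x := by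
    simpa using (hasDerivAt_id' x).fun_pow 2
  rw [mul_comm]
  exact HasDerivWithinAt.comp_hasDerivAt (h := fun x => x ^ 2) x (hh _ (sq_nonneg x)) hsq
    (.of_forall fun y => sq_nonneg y)

namespace HasBoundedDerivs

variable {h h' h'' : ℝ → ℝ} {A B : ℝ}

theorem lipschitzOnWith (hh : HasBoundedDerivs h h' h'' A B) :
    LipschitzOnWith A.toNNReal h (Ici 0) :=
  (convex_Ici 0).lipschitzOnWith_of_nnnorm_hasDerivWithin_le hh.hasDerivWithinAt
    fun x hx => NNReal.le_toNNReal_of_coe_le (hh.bound x hx)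

theorem abs_sub_le (hh : HasBoundedDerivs h h' h'' A B) {x y : ℝ} (hx : 0 ≤ x) (hy : 0 ≤ y) :
    |h x - h y| ≤ A * |x - y| :=
  (convex_Ici 0).norm_image_sub_le_of_norm_hasDerivWithin_le hh.hasDerivWithinAt hh.bound hy hx

theorem integrable (hh : HasBoundedDerivs h h' h'' A B) {ν : Measure ℝ} [IsFiniteMeasure ν]
    (hν : ∀ᵐ x ∂ν, x ∈ Ici 0) (hid : Integrable (fun x => x) ν) : Integrable h ν :=
  integrable_of_lipschitzOnWith hh.lipschitzOnWith measurableSet_Ici self_mem_Ici hν hid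

theorem integrable_chiSquare (hh : HasBoundedDerivs h h' h'' A B) (p : ℕ) :
    Integrable h (chiSquare p) :=
  hh.integrable (ae_mem_Ici_chiSquare p) (integrable_id_chiSquare p)

theorem abs_sub_integral_le (hh : HasBoundedDerivs h h' h'' A B) (p : ℕ) {x : ℝ} (hx : 0 ≤ x) :
    |h x - ∫ y, h y ∂(chiSquare p)| ≤ A * (p + x) := by
  have hA : 0 ≤ A := (abs_nonneg _).trans (hh.bound 0 self_mem_Ici)
  have hid := integrable_id_chiSquare p
  calc |h x - ∫ y, h y ∂(chiSquare p)| = ‖∫ y, (h x - h y) ∂(chiSquare p)‖ := by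
        rw [integral_sub (integrable_const _) (hh.integrable_chiSquare p)]
        simp
    _ ≤ ∫ y, A * (y + x) ∂(chiSquare p) := by
        refine norm_integral_le_of_norm_le ((hid.add (integrable_const x)).const_mul A) ?_
        filter_upwards [ae_mem_Ici_chiSquare p] with y hy
        refine (hh.abs_sub_le hx hy).trans (mul_le_mul_of_nonneg_left ?_ hA)
        exact abs_sub_le_iff.2 ⟨by linarith [mem_Ici.1 hy], by linarith [mem_Ici.1 hy]⟩
    _ = A * (p + x) := by
        rw [integral_const_mul, integral_add hid (integrable_const x), integral_id_chiSquare]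
        simp

theorem hasQuadraticGrowth (hh : HasBoundedDerivs h h' h'' A B) :
    HasQuadraticGrowth (fun x => h (x ^ 2) - ∫ y, h y ∂(chiSquare 1))
      (fun x => 2 * x * h' (x ^ 2)) (fun x => 2 * h' (x ^ 2) + 4 * x ^ 2 * h'' (x ^ 2)) A
      (4 * B) where
  hasDerivAt x := (hasDerivAt_comp_sq hh.hasDerivWithinAt x).sub_const _
  hasDerivAt_deriv x := (((hasDerivAt_id' x).const_mul 2).fun_mul
    (hasDerivAt_comp_sq hh.hasDerivWithinAt_deriv x)).congr_deriv (by ring)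
  nonneg := mul_nonneg zero_le_four ((abs_nonneg _).trans (hh.bound_deriv 0 self_mem_Ici))
  bound x := by simpa using hh.abs_sub_integral_le 1 (sq_nonneg x)
  bound_deriv x := by
    rw [abs_mul, abs_mul, abs_two]
    linarith [mul_le_mul_of_nonneg_left (hh.bound _ (sq_nonneg x))
      (by positivity : 0 ≤ 2 * |x|)]
  bound_deriv_deriv x := by
    refine (abs_add_le _ _).trans ?_
    rw [abs_mul, abs_mul, abs_two, abs_of_nonneg (by positivity : 0 ≤ 4 * x ^ 2)]
    linarith [hh.bound _ (sq_nonneg x), mul_le_mul_of_nonneg_left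
      (hh.bound_deriv _ (sq_nonneg x)) (by positivity : 0 ≤ 4 * x ^ 2)]

theorem continuous_comp_sq (hh : HasBoundedDerivs h h' h'' A B) : Continuous fun x => h (x ^ 2) :=
  hh.lipschitzOnWith.continuousOn.comp_continuous (by fun_prop) fun x => sq_nonneg x

theorem isSteinSolution (hh : HasBoundedDerivs h h' h'' A B) :
    IsSteinSolution (steinSol fun x => h (x ^ 2) - ∫ y, h y ∂(chiSquare 1))
      (fun x => h (x ^ 2) - ∫ y, h y ∂(chiSquare 1)) := by
  have hint := hh.integrable_chiSquare 1
  have hmeas := hint.aestronglyMeasurable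
  rw [chiSquare_one_eq_map] at hint hmeas
  have hint_sq : Integrable (fun x => h (x ^ 2)) (gaussianReal 0 1) :=
    (integrable_map_measure hmeas (by fun_prop)).1 hint
  refine isSteinSolution_steinSol (hh.continuous_comp_sq.sub continuous_const)
    (hint_sq.sub (integrable_const _)) ?_
  rw [integral_sub hint_sq (integrable_const _), chiSquare_one_eq_map,
    integral_map (by fun_prop) hmeas]
  simp

end HasBoundedDerivs

end TestFunctions

theorem IsScaledRademacher.abs_integral_comp_sum_sq_sub_le {Ω ι : Type*} [MeasurableSpace Ω]
    {P : Measure Ω} [IsProbabilityMeasure P] [Fintype ι] {c : ι → ℝ} {X : ι → Ω → ℝ}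
    (hX : IsScaledRademacher P c X) (hc : ∑ i, c i ^ 2 = 1) {h h' h'' : ℝ → ℝ} {A B : ℝ}
    (hh : HasBoundedDerivs h h' h'' A B) :
    |∫ ω, h ((∑ i, X i ω) ^ 2) ∂P - ∫ y, h y ∂(chiSquare 1)| ≤
      (∑ i, c i ^ 4) * (12 * A + 8 * B) := by
  have hle := hX.abs_integral_le_of_isSteinSolution hc hh.isSteinSolution hh.hasQuadraticGrowth
  have hint : Integrable (fun ω => h ((∑ i, X i ω) ^ 2)) P :=
    hX.integrable_comp (f := fun x => h ((∑ i, x i) ^ 2))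
      (hh.continuous_comp_sq.comp (by fun_prop : Continuous fun x : ι → ℝ => ∑ i, x i))
  rw [integral_sub hint (integrable_const _), integral_const, probReal_univ, one_smul] at hle
  exact hle.trans_eq (by ring)

section Smoothing

/-- The Steklov mean of `h`: its average over `[x, x + s]`. -/
noncomputable def steklovMean (s : ℝ) (h : ℝ → ℝ) (x : ℝ) : ℝ :=
  s⁻¹ * ∫ t in x..x + s, h t

variable {h : ℝ → ℝ} {K : NNReal} {s : ℝ}

theorem hasDerivAt_steklovMean (hh : Continuous h) (s x : ℝ) :
    HasDerivAt (steklovMean s h) (s⁻¹ * (h (x + s) - h x)) x := by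
  have hprim (y : ℝ) := (hh.integral_hasStrictDerivAt 0 y).hasDerivAt
  refine ((((hprim (x + s)).comp_add_const x s).fun_sub (hprim x)).const_mul
    s⁻¹).congr_of_eventuallyEq (.of_forall fun y => ?_)
  simp only [steklovMean, intervalIntegral.integral_interval_sub_left
    (hh.intervalIntegrable _ _) (hh.intervalIntegrable _ _)]

theorem abs_inv_mul_sub_le_of_lipschitzWith (hh : LipschitzWith K h) (hs : 0 < s) (x : ℝ) :
    |s⁻¹ * (h (x + s) - h x)| ≤ K := by
  rw [abs_mul, abs_of_pos (inv_pos.2 hs), inv_mul_le_iff₀ hs, mul_comm]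
  simpa [abs_of_pos hs] using hh.norm_sub_le (x + s) x

theorem lipschitzWith_steklovMean (hh : LipschitzWith K h) (hs : 0 < s) :
    LipschitzWith K (steklovMean s h) := by
  have hderiv := hasDerivAt_steklovMean hh.continuous s
  refine lipschitzWith_of_nnnorm_deriv_le (fun x => (hderiv x).differentiableAt) fun x => ?_
  rw [(hderiv x).deriv]
  exact abs_inv_mul_sub_le_of_lipschitzWith hh hs x

theorem abs_steklovMean_sub_le (hh : LipschitzWith K h) (hs : 0 < s) (x : ℝ) :
    |steklovMean s h x - h x| ≤ K * s := by
  have hsub : steklovMean s h x - h x = s⁻¹ * ∫ t in x..x + s, (h t - h x) := by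
    rw [steklovMean, intervalIntegral.integral_sub (hh.continuous.intervalIntegrable _ _)
      intervalIntegrable_const, intervalIntegral.integral_const]
    field_simp
    simp
  have hle : ‖∫ t in x..x + s, (h t - h x)‖ ≤ K * s * |x + s - x| := by
    refine intervalIntegral.norm_integral_le_of_norm_le_const fun t ht => ?_
    rw [uIoc_of_le (by linarith)] at ht
    refine (hh.norm_sub_le t x).trans (mul_le_mul_of_nonneg_left ?_ K.2)
    exact abs_le.2 ⟨by linarith [ht.1], by linarith [ht.2]⟩
  rw [hsub, abs_mul, abs_of_pos (inv_pos.2 hs), inv_mul_le_iff₀ hs, mul_comm s]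
  simpa [abs_of_pos hs] using hle

theorem abs_steklovMean_steklovMean_sub_le (hh : LipschitzWith K h) (hs : 0 < s) (x : ℝ) :
    |steklovMean s (steklovMean s h) x - h x| ≤ 2 * (K * s) :=
  calc |steklovMean s (steklovMean s h) x - h x|
      ≤ |steklovMean s (steklovMean s h) x - steklovMean s h x| + |steklovMean s h x - h x| :=
        abs_sub_le _ _ _
    _ ≤ K * s + K * s := add_le_add
        (abs_steklovMean_sub_le (lipschitzWith_steklovMean hh hs) hs x)
        (abs_steklovMean_sub_le hh hs x)
    _ = 2 * (K * s) := by ring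

theorem hasBoundedDerivs_steklovMean_steklovMean (hh : LipschitzWith K h) (hs : 0 < s) :
    HasBoundedDerivs (steklovMean s (steklovMean s h))
      (fun x => s⁻¹ * (steklovMean s h (x + s) - steklovMean s h x))
      (fun x => s⁻¹ * (s⁻¹ * (h (x + s + s) - h (x + s)) - s⁻¹ * (h (x + s) - h x))) K
      (2 * K / s) where
  hasDerivWithinAt x _ :=
    (hasDerivAt_steklovMean (lipschitzWith_steklovMean hh hs).continuous s x).hasDerivWithinAt
  hasDerivWithinAt_deriv x _ :=
    ((((hasDerivAt_steklovMean hh.continuous s (x + s)).comp_add_const x s).fun_sub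
      (hasDerivAt_steklovMean hh.continuous s x)).const_mul s⁻¹).hasDerivWithinAt
  bound x _ := abs_inv_mul_sub_le_of_lipschitzWith (lipschitzWith_steklovMean hh hs) hs x
  bound_deriv x _ := by
    rw [abs_mul, abs_of_pos (inv_pos.2 hs), inv_mul_eq_div]
    gcongr
    linarith [abs_sub (s⁻¹ * (h (x + s + s) - h (x + s))) (s⁻¹ * (h (x + s) - h x)),
      abs_inv_mul_sub_le_of_lipschitzWith hh hs (x + s),
      abs_inv_mul_sub_le_of_lipschitzWith hh hs x]

theorem abs_integral_sub_integral_le {α : Type*} [MeasurableSpace α] {μ : Measure α}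
    [IsProbabilityMeasure μ] {f g : α → ℝ} {C : ℝ} (hf : Integrable f μ) (hg : Integrable g μ)
    (hfg : ∀ x, |f x - g x| ≤ C) : |∫ x, f x ∂μ - ∫ x, g x ∂μ| ≤ C := by
  rw [← integral_sub hf hg, ← Real.norm_eq_abs]
  simpa using norm_integral_le_of_norm_le_const (μ := μ) (f := fun x => f x - g x) (ae_of_all _ hfg)

-- Replacing a `1`-Lipschitz `h` by its twofold Steklov mean costs `2 * s` under each of the laws,
-- and the second derivative of that mean is at most `2 / s`.
theorem wassersteinDist_le_of_hasBoundedDerivs {μ ν : Measure ℝ} [IsProbabilityMeasure μ]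
    [IsProbabilityMeasure ν] (hμ : Integrable (fun x => x) μ) (hν : Integrable (fun x => x) ν)
    {a b : ℝ} (hs : 0 < s)
    (hsmooth : ∀ (h h' h'' : ℝ → ℝ) (A B : ℝ), HasBoundedDerivs h h' h'' A B →
      |∫ x, h x ∂μ - ∫ x, h x ∂ν| ≤ a * A + b * B) :
    wassersteinDist μ ν ≤ ENNReal.ofReal (a + 2 * b / s + 4 * s) := by
  refine iSup₂_le fun h hh => ENNReal.ofReal_le_ofReal ?_
  set g := steklovMean s (steklovMean s h)
  have hgh (x : ℝ) : |g x - h x| ≤ 2 * s := by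
    simpa using abs_steklovMean_steklovMean_sub_le hh hs x
  have hg : LipschitzWith 1 g := lipschitzWith_steklovMean (lipschitzWith_steklovMean hh hs) hs
  have hint {f : ℝ → ℝ} (hf : LipschitzWith 1 f) {ρ : Measure ℝ} [IsProbabilityMeasure ρ]
      (hρ : Integrable (fun x => x) ρ) : Integrable f ρ :=
    integrable_of_lipschitzOnWith hf.lipschitzOnWith .univ (mem_univ 0) (ae_of_all _ mem_univ) hρ
  have hgμ := abs_le.1 (abs_integral_sub_integral_le (hint hg hμ) (hint hh hμ) hgh)
  have hgν := abs_le.1 (abs_integral_sub_integral_le (hint hg hν) (hint hh hν) hgh)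
  have hgμν := abs_le.1 (hsmooth _ _ _ _ _ (hasBoundedDerivs_steklovMean_steklovMean hh hs))
  have hab : a * ((1 : NNReal) : ℝ) + b * (2 * ((1 : NNReal) : ℝ) / s) = a + 2 * b / s := by
    push_cast
    ring
  rw [hab] at hgμν
  exact abs_le.2 ⟨by linarith [hgμ.2, hgν.1, hgμν.1], by linarith [hgμ.1, hgν.2, hgμν.2]⟩

end Smoothing

section Rankings

variable {n r : ℕ}

theorem sum_centredRank (σ : Equiv.Perm (Fin r)) : ∑ j, centredRank σ j = 0 := by
  have hgauss (m : ℕ) : ∑ j : Fin m, (((j : ℕ) : ℝ) + 1) = m * (m + 1) / 2 := by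
    induction m with
    | zero => simp
    | succ m ih =>
      simp only [Fin.sum_univ_castSucc, Fin.val_castSucc, Fin.val_last, ih]
      push_cast
      ring
  simp only [centredRank, Finset.sum_sub_distrib]
  rw [Equiv.sum_comp σ fun j => ((j : ℕ) : ℝ) + 1, hgauss]
  simp
  ring

theorem sum_rankSum (σ : Fin n → Equiv.Perm (Fin r)) : ∑ j, rankSum σ j = 0 := by
  simp only [rankSum, ← Finset.mul_sum]
  rw [Finset.sum_comm]
  simp only [sum_centredRank, Finset.sum_const_zero, mul_zero]

theorem centredRank_revPerm_mul (σ : Equiv.Perm (Fin r)) (j : Fin r) :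
    centredRank (Fin.revPerm * σ) j = -centredRank σ j := by
  simp only [centredRank, Equiv.Perm.mul_apply, Fin.revPerm_apply, Fin.val_rev]
  rw [Nat.cast_sub (by omega)]
  push_cast
  ring

theorem abs_centredRank_two (σ : Equiv.Perm (Fin 2)) (j : Fin 2) : |centredRank σ j| = 1 / 2 := by
  rw [centredRank]
  rcases Fin.exists_fin_two.1 ⟨σ j, rfl⟩ with h | h <;> rw [h] <;> norm_num

theorem statistic_two (σ : Fin n → Equiv.Perm (Fin 2)) :
    statistic σ = (∑ i, 2 / √n * centredRank (σ i) 0) ^ 2 := by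
  have hneg : rankSum σ 1 = -rankSum σ 0 := by
    linarith [sum_rankSum σ, Fin.sum_univ_two (rankSum σ)]
  have hsqrt : √12 / √(2 * (2 + 1) * (n : ℝ)) = √2 / √n := by
    rw [← Real.sqrt_div (by norm_num), ← Real.sqrt_div (by norm_num)]
    congr 1
    ring
  rw [statistic, Fin.sum_univ_two, hneg, neg_sq, rankSum, Nat.cast_ofNat, hsqrt, ← Finset.mul_sum]
  simp only [mul_pow, div_pow, Real.sq_sqrt zero_le_two]
  ring

theorem statistic_nonneg {n r : ℕ} (σ : Fin n → Equiv.Perm (Fin r)) : 0 ≤ statistic σ :=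
  Finset.sum_nonneg fun j _ => sq_nonneg (rankSum σ j)

namespace IsUniformRankings

variable {Ω : Type*} [MeasurableSpace Ω] {P : Measure Ω}

theorem measurable_comp {π : Fin n → Ω → Equiv.Perm (Fin r)} (hπ : IsUniformRankings P π)
    {E : Type*} [MeasurableSpace E] (f : (Fin n → Equiv.Perm (Fin r)) → E) :
    Measurable fun ω => f fun i => π i ω :=
  (measurable_of_finite f).comp (measurable_pi_lambda _ hπ.measurable)

theorem integral_centredRank {π : Fin n → Ω → Equiv.Perm (Fin r)} (hπ : IsUniformRankings P π)
    (i : Fin n) (j : Fin r) : ∫ ω, centredRank (π i ω) j ∂P = 0 := by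
  have hmean : ∑ σ : Equiv.Perm (Fin r), centredRank σ j = 0 := by
    have hrev := Equiv.sum_comp (Equiv.mulLeft Fin.revPerm) fun σ => centredRank σ j
    simp only [Equiv.coe_mulLeft, centredRank_revPerm_mul, Finset.sum_neg_distrib] at hrev
    linarith
  have huniform (σ : Equiv.Perm (Fin r)) : (uniformOn univ).real {σ} =
      (Fintype.card (Equiv.Perm (Fin r)) : ℝ)⁻¹ := by
    simp [measureReal_def, uniformOn_univ]
  rw [← integral_map (f := fun σ => centredRank σ j) (hπ.measurable i).aemeasurable
    (measurable_of_finite _).aestronglyMeasurable, hπ.uniform, integral_fintype .of_finite]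
  simp only [huniform, smul_eq_mul, ← Finset.mul_sum, hmean, mul_zero]

variable {π : Fin n → Ω → Equiv.Perm (Fin 2)}

theorem isScaledRademacher (hπ : IsUniformRankings P π) :
    IsScaledRademacher P (fun _ => 1 / √n) (fun i ω => 2 / √n * centredRank (π i ω) 0) where
  measurable i := hπ.measurable_comp fun σ => 2 / √n * centredRank (σ i) 0
  indep := hπ.indep.comp (fun _ σ => 2 / √n * centredRank σ 0) fun _ => measurable_of_finite _
  abs_eq i := ae_of_all _ fun ω => by
    rw [abs_mul, abs_centredRank_two, abs_of_nonneg (by positivity)]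
    ring
  integral_eq_zero i := by rw [integral_const_mul, hπ.integral_centredRank, mul_zero]

variable [IsProbabilityMeasure P]

theorem integrable_statistic (hπ : IsUniformRankings P π) :
    Integrable (fun ω => statistic fun i => π i ω) P := by
  simp only [statistic_two]
  exact hπ.isScaledRademacher.integrable_comp (f := fun x => (∑ i, x i) ^ 2) (by fun_prop)

theorem abs_integral_comp_statistic_sub_le (hπ : IsUniformRankings P π) (hn : 1 ≤ n)
    {h h' h'' : ℝ → ℝ} {A B : ℝ} (hh : HasBoundedDerivs h h' h'' A B) :
    |∫ ω, h (statistic fun i => π i ω) ∂P - ∫ y, h y ∂(chiSquare 1)| ≤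
      1 / n * (12 * A + 8 * B) := by
  have hn0 : (n : ℝ) ≠ 0 := by positivity
  have hpow_four : (1 / √(n : ℝ)) ^ 4 = 1 / n * (1 / n) := by
    rw [show 4 = 2 * 2 from rfl, pow_mul, div_pow, Real.sq_sqrt n.cast_nonneg]
    ring
  have hsum_sq : ∑ _i : Fin n, (1 / √(n : ℝ)) ^ 2 = 1 := by simp [hn0]
  have hsum_four : ∑ _i : Fin n, (1 / √(n : ℝ)) ^ 4 = 1 / (n : ℝ) := by
    simp only [hpow_four, Finset.sum_const, Finset.card_univ, Fintype.card_fin, nsmul_eq_mul]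
    field_simp
  simpa only [statistic_two, hsum_four] using
    hπ.isScaledRademacher.abs_integral_comp_sum_sq_sub_le hsum_sq hh

theorem integrable_id_map_statistic (hπ : IsUniformRankings P π) :
    Integrable (fun x => x) (P.map fun ω => statistic fun i => π i ω) :=
  (integrable_map_measure (by fun_prop) (hπ.measurable_comp statistic).aemeasurable).2
    hπ.integrable_statistic

theorem integrable_map_statistic (hπ : IsUniformRankings P π) {h h' h'' : ℝ → ℝ} {A B : ℝ}
    (hh : HasBoundedDerivs h h' h'' A B) :
    Integrable h (P.map fun ω => statistic fun i => π i ω) :=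
  hh.integrable ((ae_map_iff (hπ.measurable_comp statistic).aemeasurable measurableSet_Ici).2
    (ae_of_all _ fun _ => statistic_nonneg _)) hπ.integrable_id_map_statistic

theorem wassersteinDist_statistic_le (hπ : IsUniformRankings P π) (hn : 1 ≤ n) :
    wassersteinDist (P.map fun ω => statistic fun i => π i ω) (chiSquare 1) ≤
      ENNReal.ofReal (1 / √n * (20 + 12 / √n)) := by
  have hmeas := (hπ.measurable_comp statistic).aemeasurable (μ := P)
  have := Measure.isProbabilityMeasure_map hmeas
  have hn0 : (0 : ℝ) < n := by positivity
  have hrate : 12 / (n : ℝ) + 2 * (8 / n) / (1 / √n) + 4 * (1 / √n) =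
      1 / √n * (20 + 12 / √n) := by
    have hsq : √(n : ℝ) ^ 2 = n := Real.sq_sqrt hn0.le
    field_simp
    linear_combination (12 + 16 * √(n : ℝ)) * hsq
  rw [← hrate]
  refine wassersteinDist_le_of_hasBoundedDerivs hπ.integrable_id_map_statistic
    (integrable_id_chiSquare 1) (by positivity) fun h h' h'' A B hh => ?_
  rw [integral_map hmeas (hπ.integrable_map_statistic hh).aestronglyMeasurable]
  exact (hπ.abs_integral_comp_statistic_sub_le hn hh).trans_eq (by ring)

end IsUniformRankings

end Rankings

namespace MemCb

variable {j k : ℕ} {h : ℝ → ℝ}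

theorem abs_derivPos_le_supNorm (hh : MemCb j k h) {m : ℕ} (hj : j ≤ m) (hk : m ≤ k) {x : ℝ}
    (hx : x ∈ Ici (0 : ℝ)) : |derivPos m h x| ≤ supNorm (derivPos m h) := by
  obtain ⟨C, hC⟩ := hh.bounded m hj hk
  exact le_ciSup (f := fun x : Ici (0 : ℝ) => |derivPos m h x|)
    ⟨C, forall_mem_range.2 fun y => hC y y.2⟩ ⟨x, hx⟩

theorem hasDerivWithinAt (hh : MemCb j k h) {m : ℕ} (hm : m < k) {x : ℝ} (hx : x ∈ Ici (0 : ℝ)) :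
    HasDerivWithinAt (derivPos m h) (derivPos (m + 1) h x) (Ici 0) x := by
  rw [derivPos, derivPos, iteratedDerivWithin_succ]
  exact (hh.differentiable m hm x hx).hasDerivWithinAt

theorem hasBoundedDerivs (hh : MemCb 1 2 h) :
    HasBoundedDerivs h (derivPos 1 h) (derivPos 2 h) (supNorm (derivPos 1 h))
      (supNorm (derivPos 2 h)) where
  hasDerivWithinAt x hx := by
    simpa only [derivPos, iteratedDerivWithin_zero, zero_add] using hh.hasDerivWithinAt two_pos hx
  hasDerivWithinAt_deriv x hx := hh.hasDerivWithinAt one_lt_two hx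
  bound x hx := hh.abs_derivPos_le_supNorm le_rfl one_le_two hx
  bound_deriv x hx := hh.abs_derivPos_le_supNorm one_le_two le_rfl hx

end MemCb

end Friedman

open Friedman

theorem proposition1p4 {Ω : Type*} [MeasurableSpace Ω] (P : Measure Ω) [IsProbabilityMeasure P]
    (n : ℕ) (hn : 1 ≤ n) (π : Fin n → Ω → Equiv.Perm (Fin 2))
    (hπ : Friedman.IsUniformRankings P π) (F : Ω → ℝ)
    (hF : ∀ ω, F ω = Friedman.statistic fun i => π i ω) :
    (Measurable F ∧ Integrable (fun x => x) (P.map F) ∧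
      Integrable (fun x => x) (Friedman.chiSquare 1) ∧
      Friedman.wassersteinDist (P.map F) (Friedman.chiSquare 1) ≤
        ENNReal.ofReal (1 / √(n : ℝ) * (87 + 48 / √(n : ℝ)))) ∧
    ∀ h : ℝ → ℝ, Friedman.MemCb 1 2 h →
      Integrable (fun ω => h (F ω)) P ∧ Integrable h (Friedman.chiSquare 1) ∧
      |∫ ω, h (F ω) ∂P - ∫ y, h y ∂(Friedman.chiSquare 1)| ≤
        1 / (n : ℝ) * (69 + 43 / (n : ℝ)) *
          (Friedman.supNorm (Friedman.derivPos 1 h) + Friedman.supNorm (Friedman.derivPos 2 h)) := by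
  obtain rfl : F = fun ω => statistic fun i => π i ω := funext hF
  have hmeas := hπ.measurable_comp statistic
  refine ⟨⟨hmeas, hπ.integrable_id_map_statistic, integrable_id_chiSquare 1,
    (hπ.wassersteinDist_statistic_le hn).trans (ENNReal.ofReal_le_ofReal ?_)⟩, fun h hh => ?_⟩
  · gcongr <;> norm_num
  · have hh := hh.hasBoundedDerivs
    refine ⟨(hπ.integrable_map_statistic hh).comp_measurable hmeas, hh.integrable_chiSquare 1,
      (hπ.abs_integral_comp_statistic_sub_le hn hh).trans ?_⟩
    have hA := (abs_nonneg _).trans (hh.bound 0 Set.self_mem_Ici)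
    have hB := (abs_nonneg _).trans (hh.bound_deriv 0 Set.self_mem_Ici)
    have hn_inv : 0 ≤ 43 / (n : ℝ) := by positivity
    rw [mul_assoc]
    gcongr
    nlinarith [mul_nonneg hn_inv (add_nonneg hA hB)]
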